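/- Let $G$ be a group (not necessarily countable), let $\{H_\lambda\}_{\lambda\in\Lambda}$ be a family of subgroups of $G$ and, for each $\lambda\in\Lambda$, let $\{K_{\lambda,\mu}\}_{\mu\in M_\lambda}$ be a family of subgroups of $H_\lambda$ (the index sets $\Lambda$ and $M_\lambda$ are arbitrary). Put $\mathcal H=\bigsqcup_{\lambda}(H_\lambda\setminus\{1\})$, $\mathcal K_\lambda=\bigsqcup_{\mu\in M_\lambda}(K_{\lambda,\mu}\setminus\{1\})$ and $\mathcal K=\bigsqcup_\lambda\mathcal K_\lambda$, regarded as sets of letters. *Relative presentations.* A subset $X\subset G$ is a relative generating set of $G$ with respect to a family of subgroups if $X$ together with these subgroups generates $G$. A finite relative presentation $$\langle\, X,\ H_\lambda,\ \lambda\in\Lambda \mid R=1,\ R\in\mathcal R\,\rangle \qquad (1)$$ of $G$ with respect to $\{H_\lambda\}$ consists of a finite relative generating set $X\subset G$ with respect to $\{H_\lambda\}$ and a finite set $\mathcal R$ of words over $X^{\pm1}\sqcup\mathcal H$ such that the kernel of the natural homomorphism $F=F(X)*(*_{\lambda}H_\lambda)\to G$ is the normal closure of the set of elements of $F$ represented by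 the words in $\mathcal R$. It is assumed that $\mathcal R$ is closed under inverses and cyclic shifts, and that each $R\in\mathcal R$ has minimal length among all words representing the same element of $F$. *Relative hyperbolicity.* For a word $W$ over $X^{\pm1}\sqcup\mathcal H$ representing $1$ in $G$, its relative area is the least $n$ such that $W=\prod_{i=1}^n f_i^{-1}R_if_i$ in $F$ with $f_i\in F$ and $R_i\in\mathcal R$; the relative Dehn function $\delta(n)$ is the supremum of the relative areas of all such $W$ of length at most $n$. The group $G$ is hyperbolic relative to $\{H_\lambda\}$ if it has a finite relative presentation with respect to $\{H_\lambda\}$ for which there is a constant $B$ with $\delta(n)\le Bn$ for all $n$. *The sets $\Omega_\lambda$.* An $H_\lambda$-syllable of a word is a non-empty subword consisting of letters from $H_\lambda\setminus\{1\}$ that is not contained in a longer such subword. Given (1), let $\Omega_\lambda$ be the set of all non-trivial elements of $H_\lambda$ that are represented in $G$ by an $H_\lambda$-syllable of some $R\in\mathcal R$, and put $\Omega=\bigsqcup_\lambda\Omega_\lambda$. *Cayley graphs.* For a set $S$ of letters representing elements of a group $A$, the Cayley graph $\Gamma(A,S)$ has vertex set $A$ and edge set $A\times S$, the edge $(a,s)$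 going from $a$ to $as$; it carries the path metric in which every edge (which may be traversed in both directions) has length $1$. **Statement.** Suppose that $G$ has the finite relative presentation (1) with respect to $\{H_\lambda\}$, that $G$ is hyperbolic relative to $\{H_\lambda\}$, and that $X$ is also a relative generating set of $G$ with respect to $\{K_{\lambda,\mu}\}_{\lambda\in\Lambda,\mu\in M_\lambda}$. Then for every $\lambda\in\Lambda$ the natural map $$\iota\colon \Gamma(H_\lambda,\Omega_\lambda\sqcup\mathcal K_\lambda)\to\Gamma(G,X\sqcup\Omega\sqcup\mathcal K)$$ induced by the inclusions is a quasi-isometric embedding: there are constants $\alpha\ge1$ and $\beta\ge0$ such that for all points $p,q$ of $\Gamma(H_\lambda,\Omega_\lambda\sqcup\mathcal K_\lambda)$, $$\frac1\alpha\, d(p,q)-\beta\ \le\ d(\iota(p),\iota(q))\ \le\ \alpha\, d(p,q)+\beta .$$ (Both graphs are connected; for the first one this is part of the assertion.) -/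

import Mathlib

open scoped ENNReal NNReal

/-! ### Relative generating sets, relative presentations and relative hyperbolicity -/

namespace RelHyp

section

variable {G : Type*} [Group G] {ι : Type*}

/-- `X` generates `G` relative to the family `H`: the group `G` is generated by `X` together with
all the subgroups `H i`. -/
def IsRelGenSet (X : Set G) (H : ι → Subgroup G) : Prop :=
  Subgroup.closure (X ∪ ⋃ i, (H i : Set G)) = ⊤

/-- The free product `F(X) ∗ (∗ᵢ Hᵢ)`. -/
abbrev FreeProd (X : Set G) (H : ι → Subgroup G) : Type _ :=
  Monoid.Coprod (FreeGroup X) (Monoid.CoprodI fun i => H i)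

/-- The homomorphism `F(X) ∗ (∗ᵢ Hᵢ) → G` induced by the inclusions. -/
def toGroup (X : Set G) (H : ι → Subgroup G) : FreeProd X H →* G :=
  Monoid.Coprod.lift (FreeGroup.lift fun x : X => (x : G))
    (Monoid.CoprodI.lift fun i => (H i).subtype)

/-- Letters: `gen x true` is the letter `x`, `gen x false` is its formal inverse, and `sub i h` is a
non-trivial element `h` of `H i`. Letters from different members of the family are different. -/
inductive Letter (X : Set G) (H : ι → Subgroup G)
  | gen (x : X) (b : Bool)
  | sub (i : ι) (h : H i) (hne : h ≠ 1)

/-- Words over the letters of `X` and of the disjoint union of the sets `H i \ {1}`. -/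
abbrev Word (X : Set G) (H : ι → Subgroup G) : Type _ := List (Letter X H)

variable {X : Set G} {H : ι → Subgroup G}

namespace Letter

/-- The element of the free product represented by a letter. -/
def toFree : Letter X H → FreeProd X H
  | gen x true => Monoid.Coprod.inl (FreeGroup.of x)
  | gen x false => Monoid.Coprod.inl (FreeGroup.of x)⁻¹
  | sub i h _ => Monoid.Coprod.inr (Monoid.CoprodI.of (i := i) h)

/-- The inverse letter. -/
def inv : Letter X H → Letter X H
  | gen x b => gen x (!b)
  | sub i h hne => sub i h⁻¹ (inv_ne_one.mpr hne)

/-- The letter belongs to `H i \ {1}`. -/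
def IsIn (i : ι) : Letter X H → Prop
  | gen _ _ => False
  | sub j _ _ => j = i

end Letter

namespace Word

/-- The element of the free product represented by a word. -/
def toFree (W : Word X H) : FreeProd X H := (W.map Letter.toFree).prod

/-- The element of `G` represented by a word. -/
def eval (W : Word X H) : G := toGroup X H W.toFree

/-- The inverse word. -/
def inv (W : Word X H) : Word X H := (W.map Letter.inv).reverse

/-- `V` occurs in `W` as an `H i`-syllable: a non-empty subword all of whose letters lie in
`H i \ {1}` and which is not contained in any longer such subword. -/
def IsSyllable (i : ι) (V W : Word X H) : Prop :=
  V ≠ [] ∧ (∀ l ∈ V, l.IsIn i) ∧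
    ∃ A B : Word X H, W = A ++ V ++ B ∧
      (∀ l ∈ A.getLast?, ¬ l.IsIn i) ∧ (∀ l ∈ B.head?, ¬ l.IsIn i)

end Word

/-- `⟨X, H i (i ∈ ι) ∣ R = 1 (R ∈ 𝓡)⟩` is a relative presentation of `G`, where `𝓡` is symmetric,
closed under cyclic shifts, and reduced. -/
structure IsRelPresentation (X : Set G) (H : ι → Subgroup G) (𝓡 : Set (Word X H)) : Prop where
  relGenSet : IsRelGenSet X H
  ker_eq : (toGroup X H).ker = Subgroup.normalClosure (Word.toFree '' 𝓡)
  symmetric : ∀ R ∈ 𝓡, R.inv ∈ 𝓡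
  cyclic : ∀ R ∈ 𝓡, ∀ R' : Word X H, List.IsRotated R R' → R' ∈ 𝓡
  reduced : ∀ R ∈ 𝓡, ∀ W : Word X H, W.toFree = R.toFree → R.length ≤ W.length

/-- A finite relative presentation: both `X` and `𝓡` are finite. -/
structure IsFiniteRelPresentation (X : Set G) (H : ι → Subgroup G) (𝓡 : Set (Word X H)) : Prop
    extends IsRelPresentation X H 𝓡 where
  finite_gen : X.Finite
  finite_rel : 𝓡.Finite

/-- The relative area of `W`: the least `n` such that `W = ∏_{k=1}^n f_k⁻¹ R_k f_k` in the free
product, with `R_k ∈ 𝓡`. It is `⊤` if there is no such expression. -/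
noncomputable def relArea (𝓡 : Set (Word X H)) (W : Word X H) : ℕ∞ :=
  ⨅ (L : List (FreeProd X H × Word X H)) (_ : ∀ p ∈ L, p.2 ∈ 𝓡)
    (_ : W.toFree = (L.map fun p => p.1⁻¹ * p.2.toFree * p.1).prod), (L.length : ℕ∞)

/-- The relative Dehn function (the value `⊤` means that it is not well-defined there). -/
noncomputable def relDehn (𝓡 : Set (Word X H)) (n : ℕ) : ℕ∞ :=
  ⨆ (W : Word X H) (_ : W.eval = 1) (_ : W.length ≤ n), relArea 𝓡 W

/-- `G` is hyperbolic relative to the family `H`: it has a finite relative presentation whose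
relative Dehn function is bounded by a linear function. -/
def IsRelHyperbolic (H : ι → Subgroup G) : Prop :=
  ∃ (X : Set G) (𝓡 : Set (Word X H)), IsFiniteRelPresentation X H 𝓡 ∧
    ∃ C : ℕ, ∀ n : ℕ, relDehn 𝓡 n ≤ (C : ℕ∞) * n

/-- The set `Ω i` of all non-trivial elements of `H i` represented by an `H i`-syllable of some
`R ∈ 𝓡`. -/
def Omega (𝓡 : Set (Word X H)) (i : ι) : Set (H i) :=
  {g | g ≠ 1 ∧ ∃ R ∈ 𝓡, ∃ V : Word X H, V.IsSyllable i R ∧ V.eval = (g : G)}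

end

end RelHyp

/-! ### Graphs as metric spaces -/

/-- An oriented graph (loops and multiple edges are allowed). -/
structure OGraph (V E : Type*) where
  src : E → V
  tgt : E → V

namespace OGraph

section

variable {V E : Type*}

/-- Adjacency of distinct vertices, irrespective of the orientation of edges. -/
def adjGraph (Γ : OGraph V E) : SimpleGraph V :=
  SimpleGraph.fromRel fun u v => ∃ e, Γ.src e = u ∧ Γ.tgt e = v

/-- The least length of a path, whose edges may be traversed in both directions, between two
vertices; it is `⊤` if there is no path. -/
noncomputable def vdist (Γ : OGraph V E) (u v : V) : ℝ≥0∞ := ((Γ.adjGraph.edist u v : ℕ∞) : ℝ≥0∞)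

/-- Points of the graph in which every edge is a segment of length `1`: vertices, and points at
distance `t` from the origin along an edge. The point `onEdge e 0` (resp. `onEdge e 1`) is at
distance `0` from the origin (resp. the terminus) of `e`, so the graph as a metric space is the
metric quotient of this type. -/
inductive Point (Γ : OGraph V E)
  | vertex (v : V)
  | onEdge (e : E) (t : unitInterval)

namespace Point

variable {Γ : OGraph V E}

/-- Length of a shortest path from a point to a vertex. -/
noncomputable def toVertex : Γ.Point → V → ℝ≥0∞
  | vertex u, v => Γ.vdist u v
  | onEdge e t, v => min (edist t 0 + Γ.vdist (Γ.src e) v) (edist t 1 + Γ.vdist (Γ.tgt e) v)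

/-- Distance of two points inside one edge; it is `⊤` for points that are not on one edge. -/
noncomputable def inEdge : Γ.Point → Γ.Point → ℝ≥0∞
  | onEdge e s, onEdge e' t => ⨅ _ : e = e', edist s t
  | _, _ => ⊤

/-- Length of a shortest path between two points: it stays inside one edge or it passes through a
vertex. -/
noncomputable def pdist (p q : Γ.Point) : ℝ≥0∞ :=
  min (inEdge p q) (⨅ v, p.toVertex v + q.toVertex v)

theorem vdist_self (v : V) : Γ.vdist v v = 0 := by
  simp [vdist]

theorem vdist_comm (u v : V) : Γ.vdist u v = Γ.vdist v u := by
  rw [vdist, vdist, SimpleGraph.edist_comm]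

theorem vdist_triangle (u v w : V) : Γ.vdist u w ≤ Γ.vdist u v + Γ.vdist v w := by
  have h := Γ.adjGraph.edist_triangle (u := u) (v := v) (w := w)
  rw [vdist, vdist, vdist]
  exact_mod_cast h

theorem toVertex_triangle (p : Γ.Point) (v w : V) :
    p.toVertex w ≤ p.toVertex v + Γ.vdist v w := by
  cases p with
  | vertex u => exact vdist_triangle u v w
  | onEdge e t =>
    simp only [toVertex]
    rw [min_add]
    refine min_le_min ?_ ?_ <;>
    · rw [add_assoc]
      gcongr
      exact vdist_triangle _ v w

theorem edist_zero_one_le (t : unitInterval) : (1 : ℝ≥0∞) ≤ edist t 0 + edist t 1 := by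
  have h : edist (0 : unitInterval) 1 ≤ edist t 0 + edist t 1 := by
    rw [edist_comm t 0]
    exact edist_triangle _ _ _
  have h2 : edist (0 : unitInterval) 1 = 1 := by
    rw [Subtype.edist_eq, edist_dist]
    simp
  rwa [h2] at h

theorem vdist_edge (e : E) : Γ.vdist (Γ.src e) (Γ.tgt e) ≤ 1 := by
  have h : Γ.adjGraph.edist (Γ.src e) (Γ.tgt e) ≤ 1 := by
    rw [SimpleGraph.edist_le_one_iff_adj_or_eq]
    by_cases hh : Γ.src e = Γ.tgt e
    · exact Or.inr hh
    · exact Or.inl ⟨hh, Or.inl ⟨e, rfl, rfl⟩⟩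
  rw [vdist]
  exact_mod_cast h

theorem vdist_le (p : Γ.Point) (v w : V) : Γ.vdist v w ≤ p.toVertex v + p.toVertex w := by
  cases p with
  | vertex u =>
    simp only [toVertex]
    rw [vdist_comm u v]
    exact vdist_triangle v u w
  | onEdge e t =>
    simp only [toVertex]
    have h1 := edist_zero_one_le t
    have h2 := vdist_edge (Γ := Γ) e
    have key : ∀ (a b : V) (x y : ℝ≥0∞), Γ.vdist a b ≤ x + y →
        Γ.vdist v w ≤ (x + Γ.vdist a v) + (y + Γ.vdist b w) := by
      intro a b x y h
      calc Γ.vdist v w ≤ Γ.vdist v a + Γ.vdist a w := vdist_triangle _ _ _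
        _ ≤ Γ.vdist a v + ((x + y) + Γ.vdist b w) := by
            rw [vdist_comm v a]
            gcongr
            exact (vdist_triangle _ b _).trans (by gcongr)
        _ = _ := by ring
    have hsym : Γ.vdist v w ≤ (edist t 1 + Γ.vdist (Γ.tgt e) v) +
        (edist t 0 + Γ.vdist (Γ.src e) w) := by
      refine key _ _ _ _ ?_
      rw [vdist_comm, add_comm]
      exact h2.trans h1
    rcases min_choice (edist t 0 + Γ.vdist (Γ.src e) v) (edist t 1 + Γ.vdist (Γ.tgt e) v)
      with h | h <;>
    rcases min_choice (edist t 0 + Γ.vdist (Γ.src e) w) (edist t 1 + Γ.vdist (Γ.tgt e) w)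
      with h' | h' <;> rw [h, h']
    · exact key _ _ _ _ (by rw [vdist_self]; exact zero_le)
    · exact key _ _ _ _ (h2.trans h1)
    · exact hsym
    · exact key _ _ _ _ (by rw [vdist_self]; exact zero_le)

theorem toVertex_le (p q : Γ.Point) (v : V) : p.toVertex v ≤ inEdge p q + q.toVertex v := by
  cases p with
  | vertex u => simp [inEdge]
  | onEdge e s =>
    cases q with
    | vertex u => simp [inEdge]
    | onEdge e' t =>
      by_cases h : e = e'
      · subst h
        simp only [inEdge, toVertex, iInf_pos]
        rw [add_min]
        refine min_le_min ?_ ?_ <;>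
        · rw [← add_assoc]
          gcongr
          exact edist_triangle _ _ _
      · simp [inEdge, h]

theorem inEdge_comm (p q : Γ.Point) : inEdge p q = inEdge q p := by
  cases p with
  | vertex u => cases q <;> rfl
  | onEdge e s =>
    cases q with
    | vertex u => rfl
    | onEdge e' t => simp only [inEdge, eq_comm, edist_comm]

theorem inEdge_triangle (p q r : Γ.Point) : inEdge p r ≤ inEdge p q + inEdge q r := by
  cases p with
  | vertex u => simp [inEdge]
  | onEdge e s =>
    cases q with
    | vertex u => simp [inEdge]
    | onEdge e' t =>
      cases r with
      | vertex u => simp [inEdge]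
      | onEdge e'' t' =>
        by_cases h : e = e'
        · subst h
          by_cases h' : e = e''
          · subst h'
            simpa [inEdge] using edist_triangle _ _ _
          · simp [inEdge, h']
        · simp [inEdge, h]

theorem pdist_self (p : Γ.Point) : pdist p p = 0 := by
  cases p with
  | vertex u =>
    refine le_antisymm ((min_le_right _ _).trans ((iInf_le _ u).trans ?_)) zero_le
    simp [toVertex, vdist_self]
  | onEdge e t => simp [pdist, inEdge]

theorem pdist_comm (p q : Γ.Point) : pdist p q = pdist q p := by
  simp only [pdist, inEdge_comm p q, add_comm]

theorem pdist_triangle (p q r : Γ.Point) : pdist p r ≤ pdist p q + pdist q r := by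
  have hl : ∀ a b : Γ.Point, pdist a b ≤ inEdge a b := fun a b => min_le_left _ _
  have hv : ∀ (a b : Γ.Point) (v : V), pdist a b ≤ a.toVertex v + b.toVertex v :=
    fun a b v => (min_le_right _ _).trans (iInf_le _ v)
  have h1 : ∀ v, pdist p r ≤ inEdge p q + (q.toVertex v + r.toVertex v) := fun v => by
    refine (hv p r v).trans ?_
    rw [← add_assoc]
    gcongr
    exact toVertex_le p q v
  have h2 : ∀ v, pdist p r ≤ (p.toVertex v + q.toVertex v) + inEdge q r := fun v => by
    refine (hv p r v).trans ?_
    rw [add_assoc]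
    gcongr
    rw [inEdge_comm, add_comm]
    exact toVertex_le r q v
  have h3 : ∀ v w, pdist p r ≤
      (p.toVertex v + q.toVertex v) + (q.toVertex w + r.toVertex w) := fun v w => by
    refine (hv p r w).trans ?_
    calc p.toVertex w + r.toVertex w ≤ (p.toVertex v + Γ.vdist v w) + r.toVertex w := by
          gcongr
          exact toVertex_triangle p v w
      _ ≤ (p.toVertex v + (q.toVertex v + q.toVertex w)) + r.toVertex w := by
          gcongr
          exact vdist_le q v w
      _ = _ := by ring
  rw [pdist, pdist, pdist] at *
  simp only [min_add, add_min, ENNReal.iInf_add, ENNReal.add_iInf]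
  refine le_min (le_min ?_ (le_iInf fun v => h2 v))
    (le_min (le_iInf fun v => h1 v) (le_iInf fun v => le_iInf fun w => h3 w v))
  exact (min_le_left _ _).trans (inEdge_triangle p q r)

/-- The path metric; distances are infinite between different connected components. -/
noncomputable instance : PseudoEMetricSpace Γ.Point where
  edist := pdist
  edist_self := pdist_self
  edist_comm := pdist_comm
  edist_triangle := pdist_triangle

end Point

/-- A morphism of oriented graphs. -/
structure Hom {V' E' : Type*} (Γ : OGraph V E) (Γ' : OGraph V' E') where
  onV : V → V'
  onE : E → E'
  src_onE : ∀ e, Γ'.src (onE e) = onV (Γ.src e)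
  tgt_onE : ∀ e, Γ'.tgt (onE e) = onV (Γ.tgt e)

/-- The map induced by a morphism, which maps every edge isometrically onto its image edge. -/
def Hom.onPoint {V' E' : Type*} {Γ : OGraph V E} {Γ' : OGraph V' E'} (f : Hom Γ Γ') :
    Γ.Point → Γ'.Point
  | .vertex v => .vertex (f.onV v)
  | .onEdge e t => .onEdge (f.onE e) t

end

end OGraph

/-- `f` is a quasi-isometric embedding: for some `a ≥ 1` and `b ≥ 0` it satisfies
`d(p, q) / a - b ≤ d(f p, f q) ≤ a * d(p, q) + b`. An infinite distance forces an infinite distance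
of the images. -/
def IsQuasiIsometricEmbedding {A B : Type*} [PseudoEMetricSpace A] [PseudoEMetricSpace B]
    (f : A → B) : Prop :=
  ∃ a b : ℝ≥0, 1 ≤ a ∧ ∀ p q : A,
    edist p q / a - b ≤ edist (f p) (f q) ∧ edist (f p) (f q) ≤ a * edist p q + b

/-! ### Cayley graphs -/

/-- The Cayley graph of `G` for a set `S` of letters, each of which represents an element of `G`:
the vertex set is `G` and `(g, s)` is an edge from `g` to `g * s`. -/
def cayleyGraph {G S : Type*} [Group G] (val : S → G) : OGraph G (G × S) where
  src e := e.1
  tgt e := e.1 * val e.2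

namespace RelHyp

section

variable {G : Type*} [Group G] {Λ : Type*} {M : Λ → Type*}

/-- The letters of `𝓚 l`: the disjoint union over `m` of the sets `K l m \ {1}`. -/
abbrev KLetter {H : Λ → Subgroup G} (K : ∀ l, M l → Subgroup (H l)) (l : Λ) : Type _ :=
  Σ m : M l, {k : K l m // k ≠ 1}

/-- The subgroups `K l m` of `H l`, for all `l` and `m`, as one family of subgroups of `G`. -/
def allK {H : Λ → Subgroup G} (K : ∀ l, M l → Subgroup (H l)) (p : Σ l, M l) : Subgroup G :=
  (K p.1 p.2).map (H p.1).subtype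

variable {X : Set G} {H : Λ → Subgroup G}

/-- The Cayley graph of `H l` for the letters of `Ω l` and of `𝓚 l`. -/
def localCayley (𝓡 : Set (Word X H)) (K : ∀ l, M l → Subgroup (H l)) (l : Λ) :
    OGraph (H l) (H l × (Omega 𝓡 l ⊕ KLetter K l)) :=
  cayleyGraph (Sum.elim (fun w => (w : H l)) (fun k => (k.2.1 : H l)))

/-- The Cayley graph of `G` for the letters of `X`, of the disjoint union `Ω` of all the `Ω l` and
of the disjoint union `𝓚` of all the `𝓚 l`. -/
def globalCayley (𝓡 : Set (Word X H)) (K : ∀ l, M l → Subgroup (H l)) :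
    OGraph G (G × (X ⊕ (Σ l, Omega 𝓡 l) ⊕ (Σ l, KLetter K l))) :=
  cayleyGraph (Sum.elim (fun x => (x : G))
    (Sum.elim (fun w => ((w.2 : H w.1) : G)) (fun k => ((k.2.2.1 : H k.1) : G))))

/-- The natural morphism of Cayley graphs given by the inclusions of `H l` into `G`, of `Ω l` into
`Ω` and of `𝓚 l` into `𝓚`. -/
def naturalHom (𝓡 : Set (Word X H)) (K : ∀ l, M l → Subgroup (H l)) (l : Λ) :
    OGraph.Hom (localCayley 𝓡 K l) (globalCayley 𝓡 K) where
  onV h := h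
  onE e := (e.1, Sum.inr (Sum.map (Sigma.mk l) (Sigma.mk l) e.2))
  src_onE _ := rfl
  tgt_onE e := by
    obtain ⟨h, s | s⟩ := e <;> simp [localCayley, globalCayley, cayleyGraph]

end

end RelHyp

/-! Let `u`, `v` lie in `H l` and let `W` label a path of length `n` from `u` to `v` in the big
Cayley graph. Closing it by the single letter `v⁻¹ * u` gives a loop of length `n + 1`, which by the
linear isoperimetric inequality is a product of O(n) conjugates of relators. This bounds the
distance of `u` and `v` in the Cayley graph of `H l` linearly in `n`. Since distances are extended,
that graph is connected as soon as the big one is. The other inequality holds because graph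
morphisms do not increase distances.

The bound comes from a parity argument in place of van Kampen diagrams (`edist_le_of_areaLE`). The
path and the relator loops have O(n) vertices. If `u` and `v` were further apart, some sphere around
`u` in `H l` would avoid all of these vertices. Let `f` be the indicator function of the open ball
inside that sphere. The free product acts on `G × ZMod 2` by left multiplication, with letters of `H
l` also adding the change of `f` along their edge. Letters of `H l` in `W` and in relators move
points of `H l` by at most 1, so they cannot cross the avoided sphere: `W` and all relator loops
leave the second coordinate unchanged. The closing letter joins the inside to the outside and
changes it, a contradiction.

Two more ingredients are `exists_linear_area`, which carries the isoperimetric inequality over to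
the given presentation, and `IsRelPresentation.mem_Omega`, by which letters of relators are edges of
the Cayley graph of `H l`. -/

namespace RelHyp

/-! ### Relative area, and independence of linear isoperimetry from the presentation. -/

section Area

variable {G : Type*} [Group G] {ι : Type*} {X : Set G} {H : ι → Subgroup G}

namespace Word

@[simp] theorem toFree_nil : Word.toFree ([] : Word X H) = 1 := rfl

@[simp] theorem toFree_cons (a : Letter X H) (W : Word X H) :
    Word.toFree (a :: W) = a.toFree * Word.toFree W := by
  simp [toFree]

@[simp] theorem toFree_append (V W : Word X H) :
    Word.toFree (V ++ W) = Word.toFree V * Word.toFree W := by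
  simp [toFree]

@[simp] theorem eval_nil : Word.eval ([] : Word X H) = 1 := by simp [eval]

@[simp] theorem eval_cons (a : Letter X H) (W : Word X H) :
    Word.eval (a :: W) = toGroup X H a.toFree * Word.eval W := by
  simp [eval]

end Word

@[simp] theorem toGroup_gen (x : X) :
    toGroup X H (Letter.gen x true).toFree = (x : G) := by
  simp [toGroup, Letter.toFree]

@[simp] theorem toGroup_sub (i : ι) (h : H i) (hne : h ≠ 1) :
    toGroup X H (Letter.sub (X := X) i h hne).toFree = (h : G) := by
  simp [toGroup, Letter.toFree]

theorem Letter.toFree_inv (a : Letter X H) : a.inv.toFree = a.toFree⁻¹ := by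
  cases a with
  | gen x b => cases b <;> simp [Letter.inv, Letter.toFree]
  | sub i h hne => simp [Letter.inv, Letter.toFree]

theorem Word.toFree_inv (W : Word X H) : W.inv.toFree = W.toFree⁻¹ := by
  induction W with
  | nil => simp [Word.inv]
  | cons a W ih =>
    have : Word.inv (a :: W) = Word.inv W ++ [a.inv] := by simp [Word.inv]
    rw [this]
    simp [ih, Letter.toFree_inv]

/-- Every element of the free product is represented by a word. -/
theorem Word.toFree_surjective (z : FreeProd X H) : ∃ W : Word X H, W.toFree = z := by
  have hinv : ∀ z : FreeProd X H, (∃ W : Word X H, W.toFree = z) →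
      ∃ W : Word X H, W.toFree = z⁻¹ := by
    rintro _ ⟨W, rfl⟩
    exact ⟨W.inv, W.toFree_inv⟩
  have hmul : ∀ y z : FreeProd X H, (∃ W : Word X H, W.toFree = y) →
      (∃ W : Word X H, W.toFree = z) → ∃ W : Word X H, W.toFree = y * z := by
    rintro _ _ ⟨V, rfl⟩ ⟨W, rfl⟩
    exact ⟨V ++ W, by simp⟩
  induction z using Monoid.Coprod.induction_on with
  | inl m =>
    induction m using FreeGroup.induction_on with
    | C1 => exact ⟨[], by simp⟩
    | of x => exact ⟨[.gen x true], by simp [Letter.toFree]⟩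
    | inv_of x h => rw [map_inv]; exact hinv _ h
    | mul y z hy hz => rw [map_mul]; exact hmul _ _ hy hz
  | inr n =>
    induction n using Monoid.CoprodI.induction_on with
    | one => exact ⟨[], by simp⟩
    | of i h =>
      by_cases hne : h = 1
      · exact ⟨[], by simp [hne]⟩
      · exact ⟨[.sub i h hne], by simp [Letter.toFree]⟩
    | mul y z hy hz => rw [map_mul]; exact hmul _ _ hy hz
  | mul y z hy hz => exact hmul _ _ hy hz

theorem toGroup_surjective (hX : IsRelGenSet X H) : Function.Surjective (toGroup X H) := by
  rw [← MonoidHom.range_eq_top, eq_top_iff, ← hX, Subgroup.closure_le]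
  rintro g (hg | hg)
  · exact ⟨_, toGroup_gen ⟨g, hg⟩⟩
  · obtain ⟨i, hi⟩ := Set.mem_iUnion.mp hg
    exact ⟨Monoid.Coprod.inr (Monoid.CoprodI.of (i := i) ⟨g, hi⟩), by simp [toGroup]⟩

/-- `z` is a product of at most `n` conjugates of elements of `𝓡`. -/
def AreaLE (𝓡 : Set (Word X H)) (n : ℕ) (z : FreeProd X H) : Prop :=
  ∃ L : List (FreeProd X H × Word X H), (∀ p ∈ L, p.2 ∈ 𝓡) ∧
    z = (L.map fun p => p.1⁻¹ * p.2.toFree * p.1).prod ∧ L.length ≤ n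

namespace AreaLE

variable {𝓡 : Set (Word X H)} {m n : ℕ} {y z : FreeProd X H}

theorem one : AreaLE 𝓡 n 1 := ⟨[], by simp, by simp, by simp⟩

theorem of_mem {R : Word X H} (hR : R ∈ 𝓡) : AreaLE 𝓡 1 R.toFree :=
  ⟨[(1, R)], by simpa using hR, by simp, by simp⟩

theorem mono (h : AreaLE 𝓡 m z) (hmn : m ≤ n) : AreaLE 𝓡 n z := by
  obtain ⟨L, h1, h2, h3⟩ := h
  exact ⟨L, h1, h2, h3.trans hmn⟩

theorem mul (hy : AreaLE 𝓡 m y) (hz : AreaLE 𝓡 n z) : AreaLE 𝓡 (m + n) (y * z) := by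
  obtain ⟨L, h1, rfl, h3⟩ := hy
  obtain ⟨L', h1', rfl, h3'⟩ := hz
  refine ⟨L ++ L', fun p hp => ?_, by simp, by simp; omega⟩
  rcases List.mem_append.mp hp with h | h
  exacts [h1 p h, h1' p h]

theorem conj (f : FreeProd X H) (hz : AreaLE 𝓡 n z) : AreaLE 𝓡 n (f * z * f⁻¹) := by
  obtain ⟨L, h1, rfl, h3⟩ := hz
  refine ⟨L.map fun p => (p.1 * f⁻¹, p.2), ?_, ?_, by simpa using h3⟩
  · rintro p hp
    obtain ⟨q, hq, rfl⟩ := List.mem_map.mp hp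
    exact h1 q hq
  · clear h1 h3
    induction L with
    | nil => simp
    | cons p L ih =>
      simp only [List.map_cons, List.prod_cons] at ih ⊢
      rw [← ih]
      group

theorem inv (hs : ∀ R ∈ 𝓡, R.inv ∈ 𝓡) (hz : AreaLE 𝓡 n z) : AreaLE 𝓡 n z⁻¹ := by
  obtain ⟨L, h1, rfl, h3⟩ := hz
  refine ⟨(L.map fun p => (p.1, p.2.inv)).reverse, ?_, ?_, by simpa using h3⟩
  · rintro p hp
    obtain ⟨q, hq, rfl⟩ := List.mem_map.mp (List.mem_reverse.mp hp)
    exact hs _ (h1 q hq)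
  · clear h1 h3
    induction L with
    | nil => simp
    | cons p L ih =>
      simp only [List.map_cons, List.prod_cons, List.reverse_cons, List.map_append,
        List.prod_append, List.map_nil, List.prod_nil, mul_one] at ih ⊢
      rw [← ih, Word.toFree_inv]
      group

/-- Products of elements of uniformly bounded area. -/
theorem list_prod {α : Type*} {N : ℕ} (F : α → FreeProd X H) (L : List α)
    (h : ∀ p ∈ L, AreaLE 𝓡 N (F p)) : AreaLE 𝓡 (N * L.length) (L.map F).prod := by
  induction L with
  | nil => exact one
  | cons p L ih =>
    rw [List.map_cons, List.prod_cons, List.length_cons]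
    exact ((h p (by simp)).mul (ih fun q hq => h q (by simp [hq]))).mono (by linarith)

theorem exists_of_mem_ker (hs : ∀ R ∈ 𝓡, R.inv ∈ 𝓡)
    (hker : (toGroup X H).ker = Subgroup.normalClosure (Word.toFree '' 𝓡))
    (hz : toGroup X H z = 1) : ∃ n, AreaLE 𝓡 n z := by
  rw [← MonoidHom.mem_ker, hker] at hz
  induction hz using Subgroup.closure_induction with
  | mem x hx =>
    obtain ⟨_, ⟨R, hR, rfl⟩, hc⟩ := Group.mem_conjugatesOfSet_iff.mp hx
    obtain ⟨c, rfl⟩ := isConj_iff.mp hc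
    exact ⟨1, (of_mem hR).conj c⟩
  | one => exact ⟨0, one⟩
  | mul x y _ _ hx hy =>
    obtain ⟨m, hm⟩ := hx
    obtain ⟨n, hn⟩ := hy
    exact ⟨_, hm.mul hn⟩
  | inv x _ hx =>
    obtain ⟨m, hm⟩ := hx
    exact ⟨m, hm.inv hs⟩

/-- A finite bound excludes the default value `⊤`, and an infimum of natural numbers is attained by
an actual product. -/
theorem of_relArea_le {W : Word X H} (h : relArea 𝓡 W ≤ n) : AreaLE 𝓡 n W.toFree := by
  by_contra hcon
  have : ((n + 1 : ℕ) : ℕ∞) ≤ relArea 𝓡 W := by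
    refine le_iInf fun L => le_iInf fun h1 => le_iInf fun h2 => ?_
    by_contra hlt
    refine hcon ⟨L, h1, h2, ?_⟩
    rw [Nat.cast_le] at hlt
    omega
  have := this.trans h
  rw [Nat.cast_le] at this
  omega

end AreaLE

/-- A common bound for finitely many monotone properties, each of which holds somewhere. -/
theorem exists_uniform_bound {α : Type*} {s : Set α} (hs : s.Finite) {P : α → ℕ → Prop}
    (hmono : ∀ a m n, m ≤ n → P a m → P a n) (h : ∀ a ∈ s, ∃ n, P a n) :
    ∃ n, ∀ a ∈ s, P a n := by
  induction s, hs using Set.Finite.induction_on with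
  | empty => exact ⟨0, by simp⟩
  | @insert a s _ _ ih =>
    obtain ⟨n, hn⟩ := ih fun b hb => h b (Set.mem_insert_of_mem _ hb)
    obtain ⟨m, hm⟩ := h a (Set.mem_insert _ _)
    refine ⟨max m n, fun b hb => ?_⟩
    rcases hb with rfl | hb
    · exact hmono _ _ _ (le_max_left _ _) hm
    · exact hmono _ _ _ (le_max_right _ _) (hn b hb)

/-- Two free products over `G` are compared by a homomorphism that fixes all the `H i`. -/
theorem exists_comparison (X : Set G) {X' : Set G} (hX' : IsRelGenSet X' H) :
    ∃ ψ : FreeProd X H →* FreeProd X' H, (toGroup X' H).comp ψ = toGroup X H ∧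
      ∀ (i : ι) (h : H i), ψ (Monoid.Coprod.inr (Monoid.CoprodI.of (i := i) h)) =
        Monoid.Coprod.inr (Monoid.CoprodI.of (i := i) h) := by
  choose s hs using toGroup_surjective hX'
  refine ⟨Monoid.Coprod.lift (FreeGroup.lift fun x : X => s x) Monoid.Coprod.inr, ?_, ?_⟩
  · refine Monoid.Coprod.hom_ext ?_ ?_
    · ext x
      simpa [toGroup] using hs x
    · ext i h
      simp [toGroup]
  · simp

/-- A homomorphism of free products that fixes all the `H i` increases lengths of words by at
most a constant factor. -/
theorem exists_length_bound {X' : Set G} (hX : X.Finite) (ψ : FreeProd X H →* FreeProd X' H)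
    (hψ : ∀ (i : ι) (h : H i), ψ (Monoid.Coprod.inr (Monoid.CoprodI.of (i := i) h)) =
        Monoid.Coprod.inr (Monoid.CoprodI.of (i := i) h)) :
    ∃ C : ℕ, ∀ W : Word X H, ∃ W' : Word X' H, W'.toFree = ψ W.toFree ∧
      W'.length ≤ C * W.length := by
  have := hX.to_subtype
  obtain ⟨C, hC⟩ := exists_uniform_bound (Set.finite_univ (α := X × Bool))
    (P := fun a n => ∃ W' : Word X' H,
      W'.toFree = ψ (Letter.gen a.1 a.2 : Letter X H).toFree ∧ W'.length ≤ n)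
    (fun a m n hmn ⟨W', h1, h2⟩ => ⟨W', h1, h2.trans hmn⟩)
    (fun a _ => by
      obtain ⟨W', h⟩ := Word.toFree_surjective (ψ (Letter.gen a.1 a.2 : Letter X H).toFree)
      exact ⟨W'.length, W', h, le_rfl⟩)
  refine ⟨C + 1, fun W => ?_⟩
  induction W with
  | nil => exact ⟨[], by simp, by simp⟩
  | cons a W ih =>
    obtain ⟨W', h1, h2⟩ := ih
    have : ∃ V : Word X' H, V.toFree = ψ a.toFree ∧ V.length ≤ C + 1 := by
      cases a with
      | gen x b =>
        obtain ⟨V, hV, hl⟩ := hC (x, b) trivial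
        exact ⟨V, hV, by omega⟩
      | sub i h hne => exact ⟨[.sub i h hne], by simp [Letter.toFree, hψ], by simp⟩
    obtain ⟨V, hV, hl⟩ := this
    refine ⟨V ++ W', by simp [hV, h1], ?_⟩
    rw [List.length_append, List.length_cons]
    linarith

/-- A linear isoperimetric inequality holds for every finite relative presentation if it holds
for one of them. -/
theorem exists_linear_area {𝓡 : Set (Word X H)} (hpres : IsFiniteRelPresentation X H 𝓡)
    (hhyp : IsRelHyperbolic H) :
    ∃ C : ℕ, ∀ W : Word X H, W.eval = 1 → AreaLE 𝓡 (C * W.length) W.toFree := by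
  obtain ⟨X', 𝓡', hpres', B, hB⟩ := hhyp
  obtain ⟨ψ, hψ, hψH⟩ := exists_comparison X hpres'.relGenSet
  obtain ⟨φ, hφ, hφH⟩ := exists_comparison X' hpres.relGenSet
  obtain ⟨C, hC⟩ := exists_length_bound hpres.finite_gen ψ hψH
  have hker : ∀ z, toGroup X H z = 1 → ∃ n, AreaLE 𝓡 n z := fun z hz =>
    AreaLE.exists_of_mem_ker hpres.symmetric hpres.ker_eq hz
  have hφ' : ∀ z, toGroup X H (φ z) = toGroup X' H z := fun z => DFunLike.congr_fun hφ z
  have hψ' : ∀ z, toGroup X' H (ψ z) = toGroup X H z := fun z => DFunLike.congr_fun hψ z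
  -- `N` bounds the cost of translating one relator of `𝓡'` into relators of `𝓡`.
  obtain ⟨N, hN⟩ := exists_uniform_bound hpres'.finite_rel
    (P := fun R n => AreaLE 𝓡 n (φ R.toFree)) (fun _ _ _ hmn h => h.mono hmn)
    (fun R hR => hker _ (by
      rw [hφ', ← MonoidHom.mem_ker, hpres'.ker_eq]
      exact Subgroup.subset_normalClosure ⟨R, hR, rfl⟩))
  have := hpres.finite_gen.to_subtype
  -- `φ ∘ ψ` need not be the identity, but it changes each of the finitely many letters of `X^{±1}`
  -- by an element of the kernel; letters from the `H i` are fixed, so their number is irrelevant.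
  obtain ⟨A, hA⟩ := exists_uniform_bound (Set.finite_univ (α := X × Bool))
    (P := fun a n => AreaLE 𝓡 n ((Letter.gen a.1 a.2 : Letter X H).toFree *
      (φ (ψ (Letter.gen a.1 a.2 : Letter X H).toFree))⁻¹)) (fun _ _ _ hmn h => h.mono hmn)
    (fun a _ => hker _ (by simp [hφ', hψ']))
  have hletter : ∀ a : Letter X H, AreaLE 𝓡 A (a.toFree * (φ (ψ a.toFree))⁻¹) := by
    intro a
    cases a with
    | gen x b => exact hA (x, b) trivial
    | sub i h hne => simpa [Letter.toFree, hψH, hφH] using AreaLE.one (𝓡 := 𝓡) (n := A)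
  have hword : ∀ W : Word X H, AreaLE 𝓡 (A * W.length) (W.toFree * (φ (ψ W.toFree))⁻¹) := by
    intro W
    induction W with
    | nil => simpa using AreaLE.one (𝓡 := 𝓡) (n := 0)
    | cons a W ih =>
      have h := (ih.conj a.toFree).mul (hletter a)
      have he : Word.toFree (a :: W) * (φ (ψ (Word.toFree (a :: W))))⁻¹ =
          a.toFree * (Word.toFree W * (φ (ψ (Word.toFree W)))⁻¹) * a.toFree⁻¹ *
            (a.toFree * (φ (ψ a.toFree))⁻¹) := by
        rw [Word.toFree_cons, map_mul, map_mul]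
        group
      rw [List.length_cons, he]
      exact h
  -- Write `W` as (W · φψ(W)⁻¹) · φψ(W). The first factor costs `A` per letter. The second is the
  -- image of a word of length at most `C * W.length`, hence of at most `B * C * W.length`
  -- conjugated relators, at cost `N` each.
  refine ⟨A + N * B * C, fun W hW => ?_⟩
  obtain ⟨W', hW', hlen⟩ := hC W
  have heval : W'.eval = 1 := by rw [Word.eval, hW', hψ']; exact hW
  have h1 : relArea 𝓡' W' ≤ ((B * W'.length : ℕ) : ℕ∞) := by
    rw [Nat.cast_mul]
    refine le_trans ?_ (hB W'.length)
    exact le_iSup_of_le W' (le_iSup_of_le heval (le_iSup_of_le le_rfl le_rfl))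
  obtain ⟨L, hL, hprod, hLlen⟩ := AreaLE.of_relArea_le h1
  have h2 : AreaLE 𝓡 (N * L.length) (φ (ψ W.toFree)) := by
    rw [← hW', hprod, map_list_prod, List.map_map]
    refine AreaLE.list_prod _ L fun p hp => ?_
    simpa using (hN p.2 (hL p hp)).conj (φ p.1)⁻¹
  have h3 := (hword W).mul h2
  rw [inv_mul_cancel_right] at h3
  refine h3.mono ?_
  have : N * L.length ≤ N * (B * (C * W.length)) := by gcongr; exact hLlen.trans (by gcongr)
  linarith

end Area

end RelHyp

namespace RelHyp

/-! ### An action of the free product on `G × ZMod 2` twisted along one subgroup. -/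

section Twist

variable {G : Type*} [Group G] {ι : Type*} {X : Set G} {H : ι → Subgroup G}

/-- Left multiplication on the first factor of `G × ZMod 2`. -/
def leftPerm (G : Type*) [Group G] : G →* Equiv.Perm (G × ZMod 2) where
  toFun g := (Equiv.mulLeft g).prodCongr (Equiv.refl _)
  map_one' := by ext <;> simp
  map_mul' a b := by ext <;> simp [mul_assoc]

@[simp] theorem leftPerm_apply (g : G) (p : G × ZMod 2) : leftPerm G g p = (g * p.1, p.2) := rfl

/-- The shear of `G × ZMod 2` given by a function `f`. -/
def shear (f : G → ZMod 2) : Equiv.Perm (G × ZMod 2) where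
  toFun p := (p.1, p.2 + f p.1)
  invFun p := (p.1, p.2 - f p.1)
  left_inv p := by simp
  right_inv p := by simp

open Classical in
/-- The action of the free product on `G × ZMod 2` through its action on `G` by left
multiplications, where the action of `H l` is conjugated by a shear. -/
noncomputable def twistedAction (X : Set G) (H : ι → Subgroup G) (l : ι) (f : G → ZMod 2) :
    FreeProd X H →* Equiv.Perm (G × ZMod 2) :=
  Monoid.Coprod.lift ((leftPerm G).comp (FreeGroup.lift fun x : X => (x : G)))
    (Monoid.CoprodI.lift fun i => if i = l then
        ((MulAut.conj (shear f)⁻¹).toMonoidHom.comp (leftPerm G)).comp (H i).subtype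
      else (leftPerm G).comp (H i).subtype)

variable {l : ι} {f : G → ZMod 2}

theorem twistedAction_gen (x : X) (b : Bool) (p : G × ZMod 2) :
    twistedAction X H l f (Letter.gen x b).toFree p =
      (toGroup X H (Letter.gen x b).toFree * p.1, p.2) := by
  cases b
  · simp [twistedAction, Letter.toFree, toGroup]
    rfl
  · simp [twistedAction, Letter.toFree, toGroup]

theorem twistedAction_sub_of_ne {i : ι} (hi : i ≠ l) (h : H i) (hne : h ≠ 1) (p : G × ZMod 2) :
    twistedAction X H l f (Letter.sub i h hne).toFree p = (h * p.1, p.2) := by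
  simp [twistedAction, Letter.toFree, hi]

theorem twistedAction_sub (h : H l) (hne : h ≠ 1) (p : G × ZMod 2) :
    twistedAction X H l f (Letter.sub l h hne).toFree p =
      (h * p.1, p.2 + f p.1 - f (h * p.1)) := by
  simp [twistedAction, Letter.toFree]
  rfl

/-- The vertices of the path labelled by `W` that ends at `g`, where letters act on the left. -/
def vertices (W : Word X H) (g : G) : List G := W.tails.map fun V => Word.eval V * g

@[simp] theorem length_vertices (W : Word X H) (g : G) :
    (vertices W g).length = W.length + 1 := by simp [vertices]

theorem vertices_cons (a : Letter X H) (W : Word X H) (g : G) :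
    vertices (a :: W) g = (Word.eval (a :: W) * g) :: vertices W g := by simp [vertices]

theorem eval_mul_mem_vertices (W : Word X H) (g : G) : W.eval * g ∈ vertices W g := by
  cases W <;> simp [vertices]

/-- If `f` is constant along all the edges of the path that are labelled by letters from `H l`,
then the action of `W` is not twisted. -/
theorem twistedAction_word (P : G → Prop)
    (W : Word X H) (hf : ∀ h hne, Letter.sub l h hne ∈ W →
      ∀ g, P g → P (h * g) → f (h * g) = f g)
    (g : G) (hP : ∀ g' ∈ vertices W g, P g') (i : ZMod 2) :
    twistedAction X H l f W.toFree (g, i) = (W.eval * g, i) := by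
  induction W with
  | nil => simp
  | cons a W ih =>
    rw [vertices_cons] at hP
    have ih := ih (fun h hne hm => hf h hne (List.mem_cons_of_mem _ hm))
      (fun g' hg' => hP g' (List.mem_cons_of_mem _ hg'))
    rw [Word.toFree_cons, map_mul, Equiv.Perm.mul_apply, ih, Word.eval_cons, mul_assoc]
    cases a with
    | gen x b => rw [twistedAction_gen]
    | sub j h hne =>
      rw [toGroup_sub]
      by_cases hj : j = l
      · subst hj
        have h1 := hP _ (List.mem_cons_of_mem _ (eval_mul_mem_vertices W g))
        have h2 := hP _ List.mem_cons_self
        rw [Word.eval_cons, toGroup_sub, mul_assoc] at h2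
        rw [twistedAction_sub]
        simp [hf h hne List.mem_cons_self _ h1 h2]
      · rw [twistedAction_sub_of_ne hj]

/-- Shears preserve first coordinates. This locates the base point of a conjugated relator loop,
whatever the conjugator does to the second coordinate. -/
theorem twistedAction_fst (z : FreeProd X H) (p : G × ZMod 2) :
    (twistedAction X H l f z p).1 = toGroup X H z * p.1 := by
  obtain ⟨W, rfl⟩ := Word.toFree_surjective z
  induction W generalizing p with
  | nil => simp
  | cons a W ih =>
    rw [Word.toFree_cons, map_mul, map_mul, Equiv.Perm.mul_apply, mul_assoc, ← ih]
    cases a with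
    | gen x b => rw [twistedAction_gen]
    | sub j h hne =>
      by_cases hj : j = l
      · subst hj
        rw [twistedAction_sub, toGroup_sub]
      · rw [twistedAction_sub_of_ne hj, toGroup_sub]

end Twist

/-! ### The parity argument: area bounds distance in `H l`. -/

section Distance

variable {G : Type*} [Group G] {ι : Type*} {X : Set G} {H : ι → Subgroup G} {l : ι}

/-- A function omits on a list `L` some natural number that is at most the length of `L`. -/
theorem exists_omitted_value {α : Type*} (D : α → ℕ∞) (L : List α) :
    ∃ k : ℕ, k ≤ L.length ∧ ∀ a ∈ L, D a ≠ k := by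
  classical
  by_contra! hcon
  have hsub : (Finset.range (L.length + 1)).image (fun k : ℕ => (k : ℕ∞)) ⊆
      (L.map D).toFinset := by
    intro x hx
    obtain ⟨k, hk, rfl⟩ := Finset.mem_image.mp hx
    obtain ⟨a, ha, hD⟩ := hcon k (by simpa [Nat.lt_succ_iff] using hk)
    rw [List.mem_toFinset, ← hD]
    exact List.mem_map_of_mem ha
  have h1 := Finset.card_le_card hsub
  rw [Finset.card_image_of_injective _ Nat.cast_injective, Finset.card_range] at h1
  have h2 := (L.map D).toFinset_card_le
  rw [List.length_map] at h2
  omega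

/-- Distance in `Γ` from `u` to `g⁻¹`; it is `⊤` outside `H l`. -/
noncomputable def invDist (Γ : SimpleGraph (H l)) (u : H l) (g : G) : ℕ∞ :=
  ⨅ (a : H l) (_ : (a : G) = g⁻¹), Γ.edist u a

theorem invDist_inv (Γ : SimpleGraph (H l)) (u v : H l) :
    invDist Γ u (v : G)⁻¹ = Γ.edist u v := by
  refine le_antisymm (iInf₂_le v (by simp)) (le_iInf₂ fun a ha => ?_)
  rw [inv_inv, Subtype.coe_inj] at ha
  rw [ha]

theorem edist_inv_le {Γ : SimpleGraph (H l)} {h : H l} (hh : ∀ a, Γ.edist a (a * h) ≤ 1)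
    (a : H l) : Γ.edist a (a * h⁻¹) ≤ 1 := by
  have := hh (a * h⁻¹)
  rwa [inv_mul_cancel_right, SimpleGraph.edist_comm] at this

/-- Left multiplication by `h` is right multiplication of the inverse by `h⁻¹`, hence a step of
length at most 1 in `Γ`. Inverses enter because words act on the left while Cayley graph edges
multiply on the right. Outside `H l` both sides are `⊤`. -/
theorem invDist_mul_le (Γ : SimpleGraph (H l)) (u h : H l)
    (hh : ∀ a, Γ.edist a (a * h) ≤ 1) (g : G) : invDist Γ u (h * g) ≤ invDist Γ u g + 1 := by
  simp only [invDist, ENat.iInf_add]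
  refine le_iInf₂ fun a ha => ?_
  refine (iInf₂_le (a * h⁻¹) (by simp [ha])).trans ((Γ.edist_triangle (v := a)).trans ?_)
  gcongr
  exact edist_inv_le hh a

/-- If `u` and `v` in `H l` are joined by a path labelled by `W`, then their distance in `Γ` is
bounded by the relative area of the loop formed by `W` and one edge labelled by a letter from
`H l`, provided that all letters from `H l` in `W` and in the relators move points by at most `1`
in `Γ`. -/
theorem edist_le_of_areaLE (Γ : SimpleGraph (H l)) {𝓡 : Set (Word X H)} {M N : ℕ}
    (hone : ∀ R ∈ 𝓡, R.eval = 1) (hlen : ∀ R ∈ 𝓡, R.length ≤ M)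
    (hshort : ∀ R ∈ 𝓡, ∀ h hne, Letter.sub l h hne ∈ R → ∀ a, Γ.edist a (a * h) ≤ 1)
    {W : Word X H} (hW : ∀ h hne, Letter.sub l h hne ∈ W → ∀ a, Γ.edist a (a * h) ≤ 1)
    {u v : H l} (huv : (u : G) * W.eval = v) (hne : v⁻¹ * u ≠ 1)
    (harea : AreaLE 𝓡 N (Word.toFree (Letter.sub l (v⁻¹ * u) hne :: W))) :
    Γ.edist u v ≤ ((W.length + 1 + (M + 1) * N : ℕ) : ℕ∞) := by
  classical
  obtain ⟨L, hL, hprod, hLN⟩ := harea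
  set g₀ : G := (v : G)⁻¹ with hg₀
  have hWg₀ : W.eval * g₀ = (u : G)⁻¹ := by
    rw [hg₀, ← huv, mul_inv_rev, mul_inv_cancel_left]
  -- All vertices of the path `W` and of the relator loops, each loop starting where its conjugator
  -- takes `g₀`. The endpoints of the closing edge are already on `W`.
  set V : List G := vertices W g₀ ++
    L.flatMap fun p => vertices p.2 (toGroup X H p.1 * g₀) with hV
  have hVlen : V.length ≤ W.length + 1 + (M + 1) * N := by
    rw [hV, List.length_append, length_vertices, List.length_flatMap]
    gcongr
    refine (List.sum_le_card_nsmul _ (M + 1) ?_).trans ?_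
    · intro x hx
      obtain ⟨p, hp, rfl⟩ := List.mem_map.mp hx
      simpa using hlen _ (hL p hp)
    · rw [List.length_map, smul_eq_mul, mul_comm]
      gcongr
  -- Pigeonhole: the vertices miss a sphere of radius `k` around `u`. It separates `u`, which is a
  -- vertex at level 0 and so forces `k > 0`, from `v`, which is assumed to be further away than
  -- `k`.
  obtain ⟨k, hk, hkV⟩ := exists_omitted_value (invDist Γ u) V
  by_contra! hlt
  have hkv : (k : ℕ∞) < invDist Γ u g₀ := by
    rw [hg₀, invDist_inv]
    exact lt_of_le_of_lt (by exact_mod_cast hk.trans hVlen) hlt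
  have hku : invDist Γ u (u : G)⁻¹ < k := by
    have h0 : invDist Γ u (u : G)⁻¹ = 0 := by rw [invDist_inv, SimpleGraph.edist_self]
    have := hkV _ (List.mem_append_left _ (eval_mul_mem_vertices W g₀))
    rw [hWg₀, h0] at this
    rw [h0]
    exact pos_iff_ne_zero.mpr this.symm
  set f : G → ZMod 2 := fun g => if invDist Γ u g < k then 1 else 0 with hf
  have hlevel : ∀ h : H l, (∀ a, Γ.edist a (a * h) ≤ 1) → ∀ g, invDist Γ u g ≠ k →
      invDist Γ u (h * g) ≠ k → invDist Γ u g < k → invDist Γ u (h * g) < k := by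
    intro h hh g _ h2 h3
    refine lt_of_le_of_ne ?_ h2
    exact (invDist_mul_le Γ u h hh g).trans (Order.add_one_le_of_lt h3)
  -- A step changing the level by at most 1 cannot pass from below `k` to above `k` without landing
  -- on `k`; the converse direction uses the reversed step.
  have hconst : ∀ h : H l, (∀ a, Γ.edist a (a * h) ≤ 1) → ∀ g, invDist Γ u g ≠ k →
      invDist Γ u (h * g) ≠ k → f (h * g) = f g := by
    intro h hh g h1 h2
    have : invDist Γ u (h * g) < k ↔ invDist Γ u g < k := by
      refine ⟨fun h3 => ?_, hlevel h hh g h1 h2⟩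
      have := hlevel h⁻¹ (edist_inv_le hh) (h * g) h2 (by simpa using h1) h3
      simpa using this
    simp only [hf, this]
  have hloop : twistedAction X H l f (Word.toFree (Letter.sub l (v⁻¹ * u) hne :: W)) (g₀, 0) =
      (g₀, 0) := by
    rw [hprod]
    -- The conjugator takes `(g₀, 0)` to some `(g, i)` with `i` uncontrolled; the relator fixes this
    -- point for either `i`, and the inverse conjugator leads back.
    have hfac : ∀ p ∈ L, twistedAction X H l f (p.1⁻¹ * p.2.toFree * p.1) (g₀, 0) = (g₀, 0) := by
      intro p hp
      rw [map_mul, map_mul, Equiv.Perm.mul_apply, Equiv.Perm.mul_apply, map_inv,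
        Equiv.Perm.inv_eq_iff_eq]
      have hfst := twistedAction_fst (l := l) (f := f) p.1 (g₀, 0)
      set q := twistedAction X H l f p.1 (g₀, 0)
      obtain ⟨g, i⟩ := q
      dsimp only at hfst
      have := twistedAction_word (fun g => invDist Γ u g ≠ k) p.2
        (fun h hne hm => hconst h (hshort _ (hL p hp) h hne hm)) g (fun g' hg' =>
          hkV g' (List.mem_append_right _ (List.mem_flatMap.mpr ⟨p, hp, hfst ▸ hg'⟩))) i
      rw [this, hone _ (hL p hp), one_mul]
    clear hprod hLN hkV hV hVlen hk V
    induction L with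
    | nil => simp
    | cons p L ih =>
      rw [List.map_cons, List.prod_cons, map_mul, Equiv.Perm.mul_apply,
        ih (fun q hq => hL q (List.mem_cons_of_mem _ hq))
          (fun q hq => hfac q (List.mem_cons_of_mem _ hq)), hfac p List.mem_cons_self]
  have hpath := twistedAction_word (fun g => invDist Γ u g ≠ k) W
    (fun h hne hm => hconst h (hW h hne hm)) g₀
    (fun g' hg' => hkV g' (List.mem_append_left _ hg')) 0
  -- Only the closing letter remains. Its edge runs from `u⁻¹`, where `f = 1`, to `v⁻¹`, where `f =
  -- 0`, so it adds 1 in `ZMod 2`.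
  rw [Word.toFree_cons, map_mul, Equiv.Perm.mul_apply, hpath, hWg₀, twistedAction_sub] at hloop
  have hgoal := congrArg Prod.snd hloop
  have hvu : ((v⁻¹ * u : H l) : G) * (u : G)⁻¹ = g₀ := by simp [hg₀]
  rw [hvu] at hgoal
  simp only [hf, if_pos hku, if_neg hkv.not_gt] at hgoal
  revert hgoal
  decide

end Distance

end RelHyp

namespace RelHyp

/-! ### Letters of reduced relators. -/

section Presentation

variable {G : Type*} [Group G] {ι : Type*} {X : Set G} {H : ι → Subgroup G}
  {𝓡 : Set (Word X H)}

/-- A relator has no two consecutive letters from the same subgroup. -/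
theorem IsRelPresentation.not_consecutive (hpres : IsRelPresentation X H 𝓡) {i : ι}
    {h h' : H i} {hne : h ≠ 1} {hne' : h' ≠ 1} {A B : Word X H} :
    A ++ Letter.sub i h hne :: Letter.sub i h' hne' :: B ∉ 𝓡 := by
  intro hR
  -- The two letters either cancel or merge into one; both outcomes give a shorter word for the same
  -- element, against `reduced`.
  by_cases hh : h * h' = 1
  · have := hpres.reduced _ hR (A ++ B) (by
      simp only [Word.toFree_append, Word.toFree_cons, Letter.toFree]
      rw [← mul_assoc (Monoid.Coprod.inr _), ← map_mul, ← map_mul, hh]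
      simp)
    simp at this
  · have := hpres.reduced _ hR (A ++ Letter.sub i (h * h') hh :: B) (by
      simp only [Word.toFree_append, Word.toFree_cons, Letter.toFree]
      rw [← mul_assoc (Monoid.Coprod.inr _), ← map_mul, ← map_mul])
    simp at this

theorem Letter.IsIn.exists_eq {i : ι} {a : Letter X H} (ha : a.IsIn i) :
    ∃ h hne, a = Letter.sub i h hne := by
  cases a with
  | gen x b => exact ha.elim
  | sub j h hne =>
    obtain rfl : j = i := ha
    exact ⟨h, hne, rfl⟩

/-- The syllables of a relator are single letters. -/
theorem IsRelPresentation.mem_Omega (hpres : IsRelPresentation X H 𝓡) {R : Word X H}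
    (hR : R ∈ 𝓡) {i : ι} {h : H i} {hne : h ≠ 1} (hm : Letter.sub i h hne ∈ R) :
    h ∈ Omega 𝓡 i := by
  refine ⟨hne, R, hR, [Letter.sub i h hne], ⟨by simp, by simp [Letter.IsIn], ?_⟩, by simp⟩
  obtain ⟨A, B, rfl⟩ := List.append_of_mem hm
  refine ⟨A, B, by simp, fun a ha hin => ?_, fun a ha hin => ?_⟩
  · obtain ⟨h', hne', rfl⟩ := hin.exists_eq
    obtain ⟨A', rfl⟩ := List.getLast?_eq_some_iff.mp ha
    rw [List.append_assoc, List.singleton_append] at hR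
    exact hpres.not_consecutive hR
  · obtain ⟨h', hne', rfl⟩ := hin.exists_eq
    obtain ⟨B', rfl⟩ := List.head?_eq_some_iff.mp ha
    exact hpres.not_consecutive hR

theorem IsRelPresentation.eval_eq_one (hpres : IsRelPresentation X H 𝓡) {R : Word X H}
    (hR : R ∈ 𝓡) : R.eval = 1 := by
  rw [Word.eval, ← MonoidHom.mem_ker, hpres.ker_eq]
  exact Subgroup.subset_normalClosure ⟨R, hR, rfl⟩

end Presentation

/-! ### Paths in the Cayley graphs as words, and the lower bound on vertices. -/

section Cayley

variable {G : Type*} [Group G] {Λ : Type*} {M : Λ → Type*} {X : Set G} {H : Λ → Subgroup G}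
  {𝓡 : Set (Word X H)} {K : ∀ l, M l → Subgroup (H l)} {l : Λ}

theorem edist_edge_le_one {V E : Type*} (Γ : OGraph V E) (e : E) :
    Γ.adjGraph.edist (Γ.src e) (Γ.tgt e) ≤ 1 := by
  have := OGraph.Point.vdist_edge (Γ := Γ) e
  rw [OGraph.vdist] at this
  exact_mod_cast this

/-- All letters from `H l` in the word move the points of the Cayley graph of `H l` by at
most `1`. -/
def IsShort (K : ∀ l, M l → Subgroup (H l)) (𝓡 : Set (Word X H)) (l : Λ) (W : Word X H) : Prop :=
  ∀ h hne, Letter.sub l h hne ∈ W → ∀ a, (localCayley 𝓡 K l).adjGraph.edist a (a * h) ≤ 1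

theorem edist_mul_Omega_le_one (K : ∀ l, M l → Subgroup (H l)) (w : Omega 𝓡 l) (a : H l) :
    (localCayley 𝓡 K l).adjGraph.edist a (a * w) ≤ 1 :=
  edist_edge_le_one (localCayley 𝓡 K l) (a, Sum.inl w)

theorem edist_mul_KLetter_le_one (k : KLetter K l) (a : H l) :
    (localCayley 𝓡 K l).adjGraph.edist a (a * k.2.1) ≤ 1 :=
  edist_edge_le_one (localCayley 𝓡 K l) (a, Sum.inr k)

theorem isShort_of_mem (hpres : IsRelPresentation X H 𝓡) {R : Word X H} (hR : R ∈ 𝓡) :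
    IsShort K 𝓡 l R := fun _ _ hm a =>
  edist_mul_Omega_le_one K ⟨_, hpres.mem_Omega hR hm⟩ a

/-- The condition matters only if `i = l`: a letter from another subgroup satisfies `IsShort`
vacuously, even if both represent the same element of `G`. -/
theorem isShort_singleton {i : Λ} {h : H i} {hne : h ≠ 1}
    (hi : ∀ a, (localCayley 𝓡 K i).adjGraph.edist a (a * h) ≤ 1) :
    IsShort K 𝓡 l [Letter.sub i h hne] := by
  intro h' hne' hm
  rw [List.mem_singleton] at hm
  cases hm
  exact hi

theorem IsShort.inv {a : Letter X H} (ha : IsShort K 𝓡 l [a]) : IsShort K 𝓡 l [a.inv] := by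
  cases a with
  | gen x b => intro h hne hm; simp [Letter.inv] at hm
  | sub i h hne =>
    intro h' hne' hm
    rw [List.mem_singleton, Letter.inv] at hm
    cases hm
    exact edist_inv_le (ha h hne (by simp))

/-- Every letter of the Cayley graph of `G` is given by a short letter from `X` or `H`. -/
theorem exists_letter (e : G × (X ⊕ (Σ l, Omega 𝓡 l) ⊕ (Σ l, KLetter K l))) :
    ∃ a : Letter X H, (globalCayley 𝓡 K).src e * toGroup X H a.toFree =
      (globalCayley 𝓡 K).tgt e ∧ IsShort K 𝓡 l [a] := by
  rcases e with ⟨g, x | ⟨i, w⟩ | ⟨i, k⟩⟩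
  · exact ⟨.gen x true, by rw [toGroup_gen]; rfl, fun h hne hm => by simp at hm⟩
  · exact ⟨.sub i w w.2.1, by rw [toGroup_sub]; rfl,
      isShort_singleton (edist_mul_Omega_le_one K w)⟩
  · exact ⟨.sub i k.2.1 (by simpa using k.2.2), by rw [toGroup_sub]; rfl,
      isShort_singleton (edist_mul_KLetter_le_one k)⟩

theorem exists_letter_of_adj {x y : G} (h : (globalCayley 𝓡 K).adjGraph.Adj x y) :
    ∃ a : Letter X H, x * toGroup X H a.toFree = y ∧ IsShort K 𝓡 l [a] := by
  rcases h.2 with ⟨e, rfl, rfl⟩ | ⟨e, rfl, rfl⟩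
  · exact exists_letter e
  · obtain ⟨a, ha, hs⟩ := exists_letter (l := l) e
    refine ⟨a.inv, ?_, hs.inv⟩
    rw [Letter.toFree_inv, map_inv, ← ha, mul_inv_cancel_right]

/-- A path in the Cayley graph of `G` is labelled by a short word. -/
theorem exists_word_of_walk {x y : G} (p : (globalCayley 𝓡 K).adjGraph.Walk x y) :
    ∃ W : Word X H, W.length = p.length ∧ x * W.eval = y ∧ IsShort K 𝓡 l W := by
  induction p with
  | nil => exact ⟨[], rfl, by simp, fun h hne hm => by simp at hm⟩
  | cons h p ih =>
    obtain ⟨W, hlen, heval, hW⟩ := ih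
    obtain ⟨a, ha, has⟩ := exists_letter_of_adj (l := l) h
    refine ⟨a :: W, by simp [hlen], by rw [Word.eval_cons, ← mul_assoc, ha, heval], ?_⟩
    intro h hne hm
    rcases List.mem_cons.mp hm with rfl | hm
    · exact has h hne (by simp)
    · exact hW h hne hm

/-- The inclusion of `H l` into `G` does not contract distances of vertices by more than a
constant factor. -/
theorem exists_edist_le (K : ∀ l, M l → Subgroup (H l))
    (hpres : IsFiniteRelPresentation X H 𝓡) (hhyp : IsRelHyperbolic H) (l : Λ) :
    ∃ c : ℕ, 1 ≤ c ∧ ∀ u v : H l, (localCayley 𝓡 K l).adjGraph.edist u v ≤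
      c * ((globalCayley 𝓡 K).adjGraph.edist (u : G) (v : G) + 1) := by
  obtain ⟨C, hC⟩ := exists_linear_area hpres hhyp
  obtain ⟨N, hN⟩ := exists_uniform_bound hpres.finite_rel (P := fun R n => R.length ≤ n)
    (fun _ _ _ hmn h => h.trans hmn) (fun R _ => ⟨R.length, le_rfl⟩)
  -- For a path of length `n` the closed loop has length `n + 1` and area at most `C * (n + 1)`, so
  -- `edist_le_of_areaLE` gives `(n + 1) + (N + 1) * C * (n + 1)`.
  refine ⟨1 + (N + 1) * C, by omega, fun u v => ?_⟩
  -- Letters are non-trivial, so there is no closing letter when `u = v`.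
  by_cases hne : v⁻¹ * u = 1
  · rw [inv_mul_eq_one] at hne
    simp [hne]
  by_cases htop : (globalCayley 𝓡 K).adjGraph.edist (u : G) (v : G) = ⊤
  · rw [htop, top_add, ENat.mul_top (by simp)]
    exact le_top
  obtain ⟨p, hp⟩ := SimpleGraph.exists_walk_of_edist_ne_top htop
  obtain ⟨W, hlen, heval, hW⟩ := exists_word_of_walk (l := l) p
  have hloop : Word.eval (Letter.sub l (v⁻¹ * u) hne :: W) = 1 := by
    rw [Word.eval_cons, toGroup_sub]
    simp [mul_assoc, heval]
  have := edist_le_of_areaLE _ (fun R => hpres.eval_eq_one) hN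
    (fun R hR => isShort_of_mem (K := K) hpres.toIsRelPresentation hR) hW heval hne (hC _ hloop)
  refine this.trans (le_of_eq ?_)
  rw [← hp, List.length_cons, hlen]
  push_cast
  ring

end Cayley

end RelHyp

/-! ### From vertices to all points of the graphs. -/

namespace OGraph

variable {V E V' E' : Type*} {Γ : OGraph V E} {Γ' : OGraph V' E'}

namespace Point

theorem edist_vertex (u v : V) : edist (vertex u : Γ.Point) (vertex v) = Γ.vdist u v := by
  refine le_antisymm ((min_le_right _ _).trans ((iInf_le _ v).trans ?_)) ?_
  · simp [toVertex, vdist_self]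
  · refine le_min (by simp [inEdge]) (le_iInf fun w => ?_)
    rw [toVertex, toVertex, vdist_comm v w]
    exact vdist_triangle u w v

/-- A vertex near a given point. -/
def base : Γ.Point → V
  | vertex v => v
  | onEdge e _ => Γ.src e

theorem edist_base_le (p : Γ.Point) : edist p (vertex p.base) ≤ 1 := by
  refine (min_le_right _ _).trans ((iInf_le _ p.base).trans ?_)
  cases p with
  | vertex v => simp [toVertex, base, vdist_self]
  | onEdge e t =>
    simp only [toVertex, base, vdist_self, add_zero]
    refine (min_le_left _ _).trans ?_
    rw [Subtype.edist_eq, edist_dist, ← ENNReal.ofReal_one]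
    refine ENNReal.ofReal_le_ofReal ?_
    rw [Real.dist_eq, Set.Icc.coe_zero, sub_zero, abs_of_nonneg t.2.1]
    exact t.2.2

end Point

namespace Hom

theorem vdist_onV_le (f : Hom Γ Γ') (u v : V) : Γ'.vdist (f.onV u) (f.onV v) ≤ Γ.vdist u v := by
  rw [vdist, vdist]
  have key : ∀ {u v : V} (p : Γ.adjGraph.Walk u v),
      Γ'.adjGraph.edist (f.onV u) (f.onV v) ≤ p.length := by
    intro u v p
    induction p with
    | nil => simp
    | @cons a b c h p ih =>
      have h1 : Γ'.adjGraph.edist (f.onV a) (f.onV b) ≤ 1 := by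
        rcases h.2 with ⟨e, rfl, rfl⟩ | ⟨e, rfl, rfl⟩
        · rw [← f.src_onE, ← f.tgt_onE]
          exact RelHyp.edist_edge_le_one Γ' _
        · rw [← f.src_onE, ← f.tgt_onE, SimpleGraph.edist_comm]
          exact RelHyp.edist_edge_le_one Γ' _
      refine (Γ'.adjGraph.edist_triangle (v := f.onV b)).trans ?_
      rw [SimpleGraph.Walk.length_cons, Nat.cast_add, Nat.cast_one, add_comm]
      gcongr
  have : Γ'.adjGraph.edist (f.onV u) (f.onV v) ≤ Γ.adjGraph.edist u v := le_iInf fun p => key p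
  exact_mod_cast this

theorem toVertex_onPoint_le (f : Hom Γ Γ') (p : Γ.Point) (v : V) :
    (f.onPoint p).toVertex (f.onV v) ≤ p.toVertex v := by
  cases p with
  | vertex u => exact f.vdist_onV_le u v
  | onEdge e t =>
    simp only [onPoint, Point.toVertex, f.src_onE, f.tgt_onE]
    gcongr <;> exact f.vdist_onV_le _ _

theorem edist_onPoint_le (f : Hom Γ Γ') (p q : Γ.Point) :
    edist (f.onPoint p) (f.onPoint q) ≤ edist p q := by
  refine le_min ((min_le_left _ _).trans ?_) (le_iInf fun v => (min_le_right _ _).trans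
    ((iInf_le _ (f.onV v)).trans
      (add_le_add (f.toVertex_onPoint_le p v) (f.toVertex_onPoint_le q v))))
  cases p with
  | vertex u => simp [Point.inEdge]
  | onEdge e s =>
    cases q with
    | vertex u => simp [Point.inEdge]
    | onEdge e' t =>
      by_cases h : e = e'
      · subst h; simp [Point.inEdge, onPoint]
      · simp [Point.inEdge, h]

theorem base_onPoint (f : Hom Γ Γ') (p : Γ.Point) : (f.onPoint p).base = f.onV p.base := by
  cases p with
  | vertex u => rfl
  | onEdge e t => exact f.src_onE e

/-- A morphism of graphs that does not contract distances of vertices by more than a constant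
factor is a quasi-isometric embedding. -/
theorem isQuasiIsometricEmbedding (f : Hom Γ Γ') {c : ℕ} (hc : 1 ≤ c)
    (h : ∀ u v, Γ.adjGraph.edist u v ≤ c * (Γ'.adjGraph.edist (f.onV u) (f.onV v) + 1)) :
    IsQuasiIsometricEmbedding f.onPoint := by
  have hc' : (1 : ℝ≥0∞) ≤ c := by exact_mod_cast hc
  -- The 5 is 2 for moving both points to vertices in `Γ` (absorbed using `1 ≤ c`), 2 for the same
  -- in `Γ'`, and 1 from the hypothesis `h`.
  refine ⟨c, 5, by exact_mod_cast hc, fun p q => ⟨?_, ?_⟩⟩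
  · have hv : Γ.vdist p.base q.base ≤ c * (Γ'.vdist (f.onV p.base) (f.onV q.base) + 1) := by
      rw [vdist, vdist]
      exact_mod_cast h p.base q.base
    have hpq : edist p q ≤ 1 + Γ.vdist p.base q.base + 1 := by
      rw [← Point.edist_vertex]
      refine (edist_triangle4 p (.vertex p.base) (.vertex q.base) q).trans ?_
      gcongr
      · exact p.edist_base_le
      · rw [edist_comm]; exact q.edist_base_le
    have hpq' : Γ'.vdist (f.onV p.base) (f.onV q.base) ≤
        1 + edist (f.onPoint p) (f.onPoint q) + 1 := by
      rw [← Point.edist_vertex, ← base_onPoint, ← base_onPoint]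
      refine (edist_triangle4 _ (f.onPoint p) (f.onPoint q) _).trans ?_
      gcongr
      · rw [edist_comm]; exact (f.onPoint p).edist_base_le
      · exact (f.onPoint q).edist_base_le
    rw [tsub_le_iff_right]
    refine ENNReal.div_le_of_le_mul' ?_
    calc edist p q ≤ 1 + Γ.vdist p.base q.base + 1 := hpq
      _ ≤ c + c * ((1 + edist (f.onPoint p) (f.onPoint q) + 1) + 1) + c := by
        gcongr
        exact hv.trans (by gcongr)
      _ = c * (edist (f.onPoint p) (f.onPoint q) + 5) := by ring
      _ = _ := by simp
  · refine (f.edist_onPoint_le p q).trans (le_add_right ?_)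
    refine le_mul_of_one_le_left zero_le ?_
    exact_mod_cast hc

end Hom

end OGraph

theorem mainTheorem6 {G : Type*} [Group G] {Λ : Type*} {M : Λ → Type*}
    (H : Λ → Subgroup G) (K : ∀ l, M l → Subgroup (H l))
    (X : Set G) (𝓡 : Set (RelHyp.Word X H))
    (hpres : RelHyp.IsFiniteRelPresentation X H 𝓡)
    (hhyp : RelHyp.IsRelHyperbolic H)
    (hgen : RelHyp.IsRelGenSet X (RelHyp.allK K))
    (l : Λ) :
    IsQuasiIsometricEmbedding (RelHyp.naturalHom 𝓡 K l).onPoint := by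
  obtain ⟨c, hc, h⟩ := RelHyp.exists_edist_le K hpres hhyp l
  exact (RelHyp.naturalHom 𝓡 K l).isQuasiIsometricEmbedding hc h
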